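/- Let $\sigma\ge 0$. A locally Lebesgue integrable function $f\colon\mathbb R\to\mathbb R$ is called $S^1$-almost periodic if for every $\varepsilon>0$ the set $$\Bigl\{\tau\in\mathbb R : \sup_{t\in\mathbb R}\int_t^{t+1}|f(u+\tau)-f(u)|\,du<\varepsilon\Bigr\}$$ is relatively dense, i.e. for some $l>0$ it meets every open interval of length $l$. Consider the leaky integrate-and-fire (LIF) model $\dot x(t)=-\sigma x(t)+f(t)$ for a.e. $t\in\mathbb R$, with threshold $1$ and reset value $0$; its firing map is $$\Phi(t)=\inf\Bigl\{t_*>t : e^{\sigma t}\le\int_t^{t_*}\bigl(f(u)-\sigma\bigr)e^{\sigma u}\,du\Bigr\},\qquad t\in\mathbb R,$$ which is well-defined at $t$ if the set on the right is non-empty. The firing rate at $t$ is $\mathrm{FR}(t)=\lim_{n\to\infty} n/\Phi^n(t)$, where $\Phi^n$ is the $n$-th iterate of $\Phi$; it is said to exist if all the iterates $\Phi^n(t)$ are well-defined and the limit exists. Theorem. Let $f\colon\mathbb R\to\mathbb R$ be $S^1$-almost periodic, and assume that there is $\varsigma>0$ such that $f(t)-\sigma>\varsigma$ for a.e. $t\in\mathbb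 R$. Then for every $t\in\mathbb R$ the firing rate $\mathrm{FR}(t)$ of the LIF model driven by $f$ exists, and $\mathrm{FR}(t)=\mathrm{FR}(0)\in(0,+\infty)$ for every $t\in\mathbb R$. -/

import Mathlib

open MeasureTheory Filter Topology
open scoped ENNReal

noncomputable section

/-- A set `A ⊆ ℝ` is relatively dense if, for some `l > 0`, it meets every open interval of
length `l`. -/
def RelativelyDense (A : Set ℝ) : Prop :=
  ∃ l : ℝ, 0 < l ∧ ∀ x : ℝ, (A ∩ Set.Ioo x (x + l)).Nonempty

/-- The Stepanov norm `‖f‖ = sup_t ∫_t^{t+1} |f(u)| du` (exponent one, unit window), with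
values in `[0, ∞]` because the supremum may be infinite. -/
def stepanovNorm (f : ℝ → ℝ) : ℝ≥0∞ :=
  ⨆ t : ℝ, ∫⁻ u in Set.Ioc t (t + 1), ‖f u‖ₑ

/-- The `(S¹, ε)`-almost periods of `f`: the `τ` with `‖f(· + τ) - f‖ < ε`. -/
def stepanovAlmostPeriods (ε : ℝ) (f : ℝ → ℝ) : Set ℝ :=
  {τ : ℝ | stepanovNorm (fun u => f (u + τ) - f u) < ENNReal.ofReal ε}

/-- `S¹`-almost periodic functions. -/
structure StepanovAlmostPeriodic (f : ℝ → ℝ) : Prop where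
  locallyIntegrable : LocallyIntegrable f volume
  relativelyDense : ∀ ε : ℝ, 0 < ε → RelativelyDense (stepanovAlmostPeriods ε f)

/-- The times `t' > t` at which the trajectory of `x' = -σ x + f` started from `x(t) = 0` is at or
above the threshold `1`. -/
def firingSet (σ : ℝ) (f : ℝ → ℝ) (t : ℝ) : Set ℝ :=
  {t' : ℝ | t < t' ∧ Real.exp (σ * t) ≤ ∫ u in t..t', (f u - σ) * Real.exp (σ * u)}

/-- The firing map. It is well-defined at `t` when `firingSet σ f t` is nonempty. -/
def firingMap (σ : ℝ) (f : ℝ → ℝ) (t : ℝ) : ℝ :=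
  sInf (firingSet σ f t)

/-- The firing rate at `t` exists and equals `r`: all iterates `Φⁿ(t)` of the firing map are
well-defined and `n / Φⁿ(t) → r`. -/
def HasFiringRate (σ : ℝ) (f : ℝ → ℝ) (t r : ℝ) : Prop :=
  (∀ n : ℕ, (firingSet σ f ((firingMap σ f)^[n] t)).Nonempty) ∧
    Tendsto (fun n : ℕ => (n : ℝ) / (firingMap σ f)^[n] t) atTop (𝓝 r)

end

/-! The firing rate is the reciprocal of a rotation number. The firing map `Φ` is monotone,
uniformly continuous, satisfies `x + d ≤ Φ x ≤ x + ς⁻¹` with `d > 0`, and nearly commutes with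
shifts by almost periods of `f` (`exists_firingMap_almost_commute`). No exact period is needed. For
fixed `k`, a relatively dense set of shifts commutes with `Φ^[k]` up to `d`, and one extra iteration
absorbs this error. Monotonicity lets `m` such blocks be chained, so the displacement of `Φ^[k * m]`
depends on the starting point only up to a constant plus `m * C`, with `C = ς⁻¹`: a relative error
of order `1 / k`. Orbits are thus almost additive, which yields the limit
(`exists_rotation_number`). -/

/-! ### Rotation numbers of monotone maps. -/

theorem iterate_le_add_mul {Φ : ℝ → ℝ} {C : ℝ} (hC : ∀ x, Φ x ≤ x + C) (n : ℕ) (x : ℝ) :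
    Φ^[n] x ≤ x + n * C := by
  induction n with
  | zero => simp
  | succ n ih =>
    rw [Function.iterate_succ_apply']
    push_cast
    linarith [hC (Φ^[n] x)]

theorem add_mul_le_iterate {Φ : ℝ → ℝ} {d : ℝ} (hd : ∀ x, x + d ≤ Φ x) (n : ℕ) (x : ℝ) :
    x + n * d ≤ Φ^[n] x := by
  induction n with
  | zero => simp
  | succ n ih =>
    rw [Function.iterate_succ_apply']
    push_cast
    linarith [hd (Φ^[n] x)]

/-- A sequence with bounded increments that is additive up to an arbitrarily small relative
error has a linear growth rate. -/
theorem exists_tendsto_div_of_almost_additive {x : ℕ → ℝ} {C : ℝ}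
    (hC : ∀ n r, |x (n + r) - x n| ≤ r * C)
    (h : ∀ δ > 0, ∃ j : ℕ, 0 < j ∧ ∀ n, |x (n + j) - x n - x j| ≤ δ * j) :
    ∃ ρ, Tendsto (fun n : ℕ => x n / n) atTop (𝓝 ρ) := by
  have hC0 : 0 ≤ C := by simpa using (abs_nonneg _).trans (hC 0 1)
  apply cauchySeq_tendsto_of_complete
  rw [Metric.cauchySeq_iff']
  have key : ∀ δ > 0, ∃ v : ℝ, ∃ N : ℕ, ∀ n ≥ N, |x n / n - v| ≤ δ := by
    intro δ hδ
    obtain ⟨j, hj, hjn⟩ := h (δ / 2) (by positivity)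
    have hj' : (0 : ℝ) < j := by exact_mod_cast hj
    have hmul : ∀ q : ℕ, |x (q * j) - x 0 - q * x j| ≤ q * (δ / 2 * j) := by
      intro q
      induction q with
      | zero => simp
      | succ q ih =>
        have := hjn (q * j)
        rw [Nat.succ_mul]
        push_cast
        rw [abs_le] at *
        constructor <;> linarith [ih.1, ih.2, this.1, this.2]
    -- `B` collects the errors that do not grow with `n`: the start, the incomplete last block, and
    -- the rounding of `n / j`. They use the other half of `δ`.
    set B : ℝ := |x 0| + j * C + |x j| with hB
    have hB0 : 0 ≤ B := by positivity
    obtain ⟨N, hN⟩ := exists_nat_gt (B / (δ / 2))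
    refine ⟨x j / j, N + 1, fun n hn => ?_⟩
    have hn0 : (0 : ℝ) < n := by exact_mod_cast (by omega : 0 < n)
    have hBn : B ≤ n * (δ / 2) := by
      rw [div_lt_iff₀ (by positivity)] at hN
      have : (N : ℝ) ≤ n := by exact_mod_cast (by omega : N ≤ n)
      nlinarith
    have e : n / j * j + n % j = n := Nat.div_add_mod' n j
    have er : ((n / j : ℕ) : ℝ) * j + ((n % j : ℕ) : ℝ) = n := by exact_mod_cast e
    have hr : ((n % j : ℕ) : ℝ) ≤ j := by exact_mod_cast (Nat.mod_lt n hj).le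
    have hr0 : (0 : ℝ) ≤ ((n % j : ℕ) : ℝ) := by positivity
    have h1 := hC (n / j * j) (n % j)
    have h2 := hmul (n / j)
    rw [e] at h1
    set q : ℝ := ((n / j : ℕ) : ℝ)
    set r : ℝ := ((n % j : ℕ) : ℝ)
    have h3 : r * C ≤ j * C := by gcongr
    have h4 : |r / j * x j| ≤ |x j| := by
      rw [abs_mul, abs_of_nonneg (by positivity)]
      exact mul_le_of_le_one_left (abs_nonneg _) ((div_le_one hj').2 hr)
    have e2 : x n / n - x j / j
        = ((x n - x (n / j * j)) + (x (n / j * j) - x 0 - q * x j) + x 0 - r / j * x j) / n := by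
      have : x n / n - x j / j = (x n - n / j * x j) / n := by field_simp
      rw [this, ← er]
      congr 1
      field_simp
      ring
    rw [e2, abs_div, abs_of_pos hn0, div_le_iff₀ hn0]
    have h5 : q * (δ / 2 * j) ≤ n * (δ / 2) := by rw [← er]; nlinarith
    have := neg_abs_le (x 0)
    have := le_abs_self (x 0)
    rw [abs_le] at *
    constructor <;> linarith [h1.1, h1.2, h2.1, h2.2, h4.1, h4.2]
  intro ε hε
  obtain ⟨v, N, hN⟩ := key (ε / 3) (by positivity)
  refine ⟨N, fun n hn => ?_⟩
  rw [Real.dist_eq]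
  have a := hN n hn
  have b := hN N le_rfl
  rw [abs_le] at *
  rw [abs_lt]
  constructor <;> linarith [a.1, a.2, b.1, b.2]

/-- If `Φ` almost commutes with a shift, its powers commute with the shift up to a
proportional number of extra iterations. -/
theorem iterate_mul_shift_le {Φ : ℝ → ℝ} (hΦ : Monotone Φ) {k : ℕ} {τ : ℝ}
    (h : ∀ x, Φ^[k] (x + τ) ≤ Φ^[k + 1] x + τ) (m : ℕ) (x : ℝ) :
    Φ^[k * m] (x + τ) ≤ Φ^[(k + 1) * m] x + τ := by
  induction m generalizing x with
  | zero => simp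
  | succ m ih =>
    rw [Nat.mul_succ, Nat.mul_succ, Function.iterate_add_apply, Function.iterate_add_apply]
    exact ((hΦ.iterate _) (h x)).trans (ih _)

theorem le_iterate_mul_shift {Φ : ℝ → ℝ} (hΦ : Monotone Φ) {k : ℕ} {τ : ℝ}
    (h : ∀ x, Φ^[k] x + τ ≤ Φ^[k + 1] (x + τ)) (m : ℕ) (x : ℝ) :
    Φ^[k * m] x + τ ≤ Φ^[(k + 1) * m] (x + τ) := by
  induction m generalizing x with
  | zero => simp
  | succ m ih =>
    rw [Nat.mul_succ, Nat.mul_succ, Function.iterate_add_apply, Function.iterate_add_apply]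
    exact (ih _).trans ((hΦ.iterate _) (h x))

/-- Existence and uniqueness of the rotation number of a monotone map whose iterates almost
commute with a relatively dense set of shifts. -/
theorem exists_rotation_number {Φ : ℝ → ℝ} (hΦ : Monotone Φ) {d C : ℝ} (hd0 : 0 < d)
    (hd : ∀ x, x + d ≤ Φ x) (hC : ∀ x, Φ x ≤ x + C)
    (hap : ∀ k : ℕ, ∃ l : ℝ, ∀ a, ∃ τ, a < τ ∧ τ < a + l ∧
      ∀ x, |Φ^[k] (x + τ) - τ - Φ^[k] x| ≤ d) :
    ∃ ρ, 0 < ρ ∧ ∀ t, Tendsto (fun n : ℕ => Φ^[n] t / n) atTop (𝓝 ρ) := by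
  have hCpos : 0 < C := by linarith [hd 0, hC 0]
  have hstep : ∀ n r x, |Φ^[n + r] x - Φ^[n] x| ≤ r * C := by
    intro n r x
    rw [add_comm, Function.iterate_add_apply, abs_le]
    have h1 := iterate_le_add_mul hC r (Φ^[n] x)
    have h2 := add_mul_le_iterate hd r (Φ^[n] x)
    have : 0 ≤ r * d := by positivity
    have : 0 ≤ r * C := by positivity
    constructor <;> linarith
  have hunif : ∀ k : ℕ, ∃ l : ℝ, ∀ (m : ℕ) (a : ℝ),
      |Φ^[k * m] a - a - Φ^[k * m] 0| ≤ l + m * C := by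
    intro k
    obtain ⟨l, hl⟩ := hap k
    refine ⟨l, fun m a => ?_⟩
    have hcomm : ∀ τ, (∀ x, |Φ^[k] (x + τ) - τ - Φ^[k] x| ≤ d) →
        Φ^[k * m] τ ≤ Φ^[(k + 1) * m] 0 + τ ∧ Φ^[k * m] 0 + τ ≤ Φ^[(k + 1) * m] τ := by
      intro τ hτ
      constructor
      · have := iterate_mul_shift_le hΦ (k := k) (τ := τ) (fun x => by
          rw [Function.iterate_succ_apply']
          linarith [hd (Φ^[k] x), (abs_le.1 (hτ x)).2]) m 0
        rwa [zero_add] at this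
      · have := le_iterate_mul_shift hΦ (k := k) (τ := τ) (fun x => by
          rw [Function.iterate_succ_apply']
          linarith [hd (Φ^[k] (x + τ)), (abs_le.1 (hτ x)).1]) m 0
        rwa [zero_add] at this
    obtain ⟨τ, h1, h2, h3⟩ := hl a
    -- Shifts on both sides of `a`, within `l`: `τ` bounds the orbit of `a` from above, `τ'` from
    -- below.
    obtain ⟨τ', h1', h2', h3'⟩ := hl (a - l)
    have A := (hcomm τ h3).1
    have B := (hcomm τ' h3').2
    have A' := hΦ.iterate (k * m) h1.le
    have B' := hΦ.iterate ((k + 1) * m) (by linarith : τ' ≤ a)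
    have e : (k + 1) * m = k * m + m := by ring
    rw [e] at A B B'
    have s0 := abs_le.1 (hstep (k * m) m 0)
    have sa := abs_le.1 (hstep (k * m) m a)
    rw [abs_le]
    constructor <;> linarith [s0.1, s0.2, sa.1, sa.2]
  obtain ⟨ρ, hρ⟩ := exists_tendsto_div_of_almost_additive (x := fun n => Φ^[n] 0) (C := C)
    (fun n r => hstep n r 0) (by
      intro δ hδ
      obtain ⟨k, hk⟩ := exists_nat_gt (2 * C / δ)
      have hk0 : (0 : ℝ) < k := lt_trans (by positivity) hk
      obtain ⟨l, hl⟩ := hunif k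
      -- Now `l + m * C ≤ 2 * m * C ≤ δ * (k * m)`; `m` comes last since `l` depends on `k`.
      obtain ⟨m, hm⟩ := exists_nat_gt (|l| / C)
      have hm0 : (0 : ℝ) < m := lt_of_le_of_lt (by positivity) hm
      refine ⟨k * m, ?_, fun n => ?_⟩
      · exact_mod_cast mul_pos hk0 hm0
      · have := hl m (Φ^[n] 0)
        rw [← Function.iterate_add_apply, add_comm] at this
        refine this.trans ?_
        rw [div_lt_iff₀ hCpos] at hm
        rw [div_lt_iff₀ hδ] at hk
        push_cast
        nlinarith [le_abs_self l])
  have hρd : d ≤ ρ := by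
    refine ge_of_tendsto hρ ?_
    filter_upwards [eventually_gt_atTop 0] with n hn
    have hn' : (0 : ℝ) < n := by exact_mod_cast hn
    rw [le_div_iff₀ hn']
    linarith [add_mul_le_iterate hd n 0]
  refine ⟨ρ, by linarith, fun t => ?_⟩
  have hbd : ∃ D, ∀ n, |Φ^[n] t - Φ^[n] 0| ≤ D := by
    -- Within `K` steps each of the orbits of `0` and `t` passes the other's start, so by
    -- monotonicity they stay interlaced.
    obtain ⟨K, hK⟩ := exists_nat_gt (|t| / d)
    have hK' : |t| ≤ K * d := by rw [div_lt_iff₀ hd0] at hK; exact hK.le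
    refine ⟨K * C, fun n => ?_⟩
    have p1 : 0 ≤ Φ^[K] t := by linarith [add_mul_le_iterate hd K t, neg_abs_le t]
    have p2 : t ≤ Φ^[K] 0 := by linarith [add_mul_le_iterate hd K 0, le_abs_self t]
    have q1 := hΦ.iterate n p1
    have q2 := hΦ.iterate n p2
    rw [← Function.iterate_add_apply] at q1 q2
    have r1 := abs_le.1 (hstep n K t)
    have r2 := abs_le.1 (hstep n K 0)
    rw [abs_le]
    constructor <;> linarith [r1.1, r1.2, r2.1, r2.2]
  obtain ⟨D, hD⟩ := hbd
  have hdiff : Tendsto (fun n : ℕ => (Φ^[n] t - Φ^[n] 0) / n) atTop (𝓝 0) := by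
    refine squeeze_zero_norm (a := fun n : ℕ => D / n) (fun n => ?_)
      (tendsto_const_div_atTop_nhds_zero_nat D)
    rw [norm_div, Real.norm_eq_abs, Real.norm_natCast]
    exact div_le_div_of_nonneg_right (hD n) (by positivity)
  have := hρ.add hdiff
  rw [add_zero] at this
  refine this.congr fun n => ?_
  rw [← add_div]
  congr 1
  ring

/-- Almost commutation with a shift passes to iterates, by uniform continuity. -/
theorem iterate_almost_commute {Φ : ℝ → ℝ}
    (huc : ∀ ε > 0, ∃ η > 0, ∀ x y, |x - y| ≤ η → |Φ x - Φ y| ≤ ε) (k : ℕ) :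
    ∀ δ > 0, ∃ η > 0, ∀ τ, (∀ x, |Φ (x + τ) - τ - Φ x| ≤ η) →
      ∀ x, |Φ^[k] (x + τ) - τ - Φ^[k] x| ≤ δ := by
  induction k with
  | zero => exact fun δ hδ => ⟨1, one_pos, fun τ _ x => by simpa using hδ.le⟩
  | succ k ih =>
    intro δ hδ
    obtain ⟨η₁, h₁, hu⟩ := huc (δ / 2) (by positivity)
    obtain ⟨η₂, h₂, hi⟩ := ih η₁ h₁
    refine ⟨min η₂ (δ / 2), by positivity, fun τ hτ x => ?_⟩
    rw [Function.iterate_succ_apply', Function.iterate_succ_apply']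
    have a := abs_le.1 (hu _ _ (hi τ (fun x => (hτ x).trans (min_le_left _ _)) x))
    have b := abs_le.1 ((hτ (Φ^[k] (x + τ) - τ)).trans (min_le_right _ _))
    rw [sub_add_cancel] at b
    rw [abs_le]
    constructor <;> linarith [a.1, a.2, b.1, b.2]

/-! ### Integral estimates for Stepanov almost periodic functions. -/

theorem StepanovAlmostPeriodic.intervalIntegrable {f : ℝ → ℝ} (hf : StepanovAlmostPeriodic f)
    (a b : ℝ) : IntervalIntegrable f volume a b :=
  (hf.locallyIntegrable.integrableOn_isCompact isCompact_uIcc).intervalIntegrable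

theorem intervalIntegrable_shift {f : ℝ → ℝ} (hI : ∀ a b, IntervalIntegrable f volume a b)
    (τ a b : ℝ) : IntervalIntegrable (fun u => f (u + τ)) volume a b := by
  have := (hI (a + τ) (b + τ)).comp_add_right τ
  simpa using this

theorem integral_le_of_mem_stepanovAlmostPeriods {f : ℝ → ℝ}
    (hI : ∀ a b, IntervalIntegrable f volume a b) {ε τ : ℝ} (hε : 0 < ε)
    (hτ : τ ∈ stepanovAlmostPeriods ε f) (t : ℝ) :
    ∫ u in t..t + 1, |f (u + τ) - f u| ≤ ε := by
  have h1 : ∫⁻ u in Set.Ioc t (t + 1), ‖f (u + τ) - f u‖ₑ < ENNReal.ofReal ε :=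
    lt_of_le_of_lt (le_iSup (fun t => ∫⁻ u in Set.Ioc t (t + 1), ‖f (u + τ) - f u‖ₑ) t) hτ
  have hint := (intervalIntegrable_shift hI τ t (t + 1)).sub (hI t (t + 1))
  rw [intervalIntegral.integral_of_le (by linarith)]
  have h2 := integral_norm_eq_lintegral_enorm (μ := volume.restrict (Set.Ioc t (t + 1)))
    (f := fun u => f (u + τ) - f u) hint.1.aestronglyMeasurable
  simp only [Real.norm_eq_abs] at h2
  rw [h2]
  exact (ENNReal.toReal_mono ENNReal.ofReal_ne_top h1.le).trans (ENNReal.toReal_ofReal hε.le).le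

theorem integral_le_mul_of_mem_stepanovAlmostPeriods {f : ℝ → ℝ}
    (hI : ∀ a b, IntervalIntegrable f volume a b) {ε τ : ℝ} (hε : 0 < ε)
    (hτ : τ ∈ stepanovAlmostPeriods ε f) (N : ℕ) {x z : ℝ} (hxz : x ≤ z) (hz : z ≤ x + N) :
    ∫ u in x..z, |f (u + τ) - f u| ≤ N * ε := by
  have hint : ∀ a b, IntervalIntegrable (fun u => |f (u + τ) - f u|) volume a b := fun a b =>
    ((intervalIntegrable_shift hI τ a b).sub (hI a b)).abs
  have h : ∀ n : ℕ, ∫ u in x..x + n, |f (u + τ) - f u| ≤ n * ε := by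
    intro n
    induction n with
    | zero => simp
    | succ n ih =>
      rw [← intervalIntegral.integral_add_adjacent_intervals (hint x (x + n)) (hint _ _)]
      have := integral_le_of_mem_stepanovAlmostPeriods hI hε hτ (x + n)
      push_cast
      rw [← add_assoc]
      linarith
  refine le_trans ?_ (h N)
  exact intervalIntegral.integral_mono_interval le_rfl hxz hz
    (Eventually.of_forall fun u => abs_nonneg _) (hint _ _)

/-- The primitive of an `S¹`-almost periodic function is uniformly continuous. -/
theorem StepanovAlmostPeriodic.exists_integral_abs_le {f : ℝ → ℝ}
    (hf : StepanovAlmostPeriodic f) {ε : ℝ} (hε : 0 < ε) :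
    ∃ h > 0, h ≤ 1 ∧ ∀ s t, s ≤ t → t ≤ s + h → ∫ u in s..t, |f u| ≤ ε := by
  have hI := hf.intervalIntegrable
  have hA : ∀ a b, IntervalIntegrable (fun u => |f u|) volume a b := fun a b => (hI a b).abs
  obtain ⟨l, hl, hτ⟩ := hf.relativelyDense (ε / 2) (by positivity)
  have hcont : Continuous fun x => ∫ u in (0 : ℝ)..x, |f u| :=
    intervalIntegral.continuous_primitive hA 0
  have huc := (isCompact_Icc (a := (0 : ℝ)) (b := l + 1)).uniformContinuousOn_of_continuous
    hcont.continuousOn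
  rw [Metric.uniformContinuousOn_iff_le] at huc
  obtain ⟨h, h0, hh⟩ := huc (ε / 2) (by positivity)
  refine ⟨min h 1, by positivity, min_le_right _ _, fun s t hst hts => ?_⟩
  have hts1 : t ≤ s + h := hts.trans (by linarith [min_le_left h 1])
  have hts2 : t ≤ s + 1 := hts.trans (by linarith [min_le_right h 1])
  -- This almost period carries `[s, t]` into the compact `[0, l + 1]`.
  obtain ⟨τ, hτ1, hτ2, hτ3⟩ := hτ (-s)
  have a := integral_le_mul_of_mem_stepanovAlmostPeriods hI (by positivity) hτ1 1 hst
    (by simpa using hts2)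
  have b := hh (t + τ) ⟨by linarith, by linarith⟩ (s + τ) ⟨by linarith, by linarith⟩
    (by rw [Real.dist_eq, abs_le]; constructor <;> linarith)
  rw [Real.dist_eq, intervalIntegral.integral_interval_sub_left (hA _ _) (hA _ _),
    ← intervalIntegral.integral_comp_add_right (fun u => |f u|)] at b
  have c : ∫ u in s..t, |f u| ≤ ∫ u in s..t, (|f (u + τ) - f u| + |f (u + τ)|) := by
    refine intervalIntegral.integral_mono_on hst (hA _ _)
      (((intervalIntegrable_shift hI τ _ _).sub (hI _ _)).abs.add
        (intervalIntegrable_shift hI τ _ _).abs) fun u _ => ?_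
    have := abs_sub_abs_le_abs_sub (f u) (f (u + τ))
    rw [abs_sub_comm] at this
    linarith
  rw [intervalIntegral.integral_add ((intervalIntegrable_shift hI τ _ _).sub (hI _ _)).abs
        (intervalIntegrable_shift hI τ _ _).abs] at c
  have := le_abs_self (∫ u in s..t, |f (u + τ)|)
  norm_num at a
  linarith

/-! ### The firing map. -/

section Firing

variable {σ ς : ℝ} {f : ℝ → ℝ}

theorem intervalIntegrable_mul_exp (hI : ∀ a b, IntervalIntegrable f volume a b) (σ a b : ℝ) :
    IntervalIntegrable (fun u => f u * Real.exp (σ * u)) volume a b :=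
  (hI a b).mul_continuousOn (by fun_prop)

theorem intervalIntegrable_drive (hI : ∀ a b, IntervalIntegrable f volume a b) (σ a b : ℝ) :
    IntervalIntegrable (fun u => (f u - σ) * Real.exp (σ * u)) volume a b :=
  ((hI a b).sub intervalIntegrable_const).mul_continuousOn (by fun_prop)

theorem mul_le_integral_drive (hσ : 0 ≤ σ) (hI : ∀ a b, IntervalIntegrable f volume a b)
    (hς : 0 < ς) (hfσ : ∀ᵐ t ∂(volume : Measure ℝ), ς < f t - σ) {a b : ℝ} (hab : a ≤ b) :
    ς * Real.exp (σ * a) * (b - a) ≤ ∫ u in a..b, (f u - σ) * Real.exp (σ * u) := by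
  have h : ∫ u in a..b, ς * Real.exp (σ * a) ≤ ∫ u in a..b, (f u - σ) * Real.exp (σ * u) := by
    refine intervalIntegral.integral_mono_ae_restrict hab intervalIntegrable_const
      (intervalIntegrable_drive hI σ a b) ?_
    filter_upwards [ae_restrict_of_ae hfσ, ae_restrict_mem measurableSet_Icc] with u hu hm
    have : Real.exp (σ * a) ≤ Real.exp (σ * u) :=
      Real.exp_le_exp.2 (mul_le_mul_of_nonneg_left hm.1 hσ)
    exact mul_le_mul hu.le this (Real.exp_pos _).le (hς.le.trans hu.le)
  rw [intervalIntegral.integral_const, smul_eq_mul] at h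
  linarith

theorem mem_firingSet_add_inv (hσ : 0 ≤ σ) (hI : ∀ a b, IntervalIntegrable f volume a b)
    (hς : 0 < ς) (hfσ : ∀ᵐ t ∂(volume : Measure ℝ), ς < f t - σ) (t : ℝ) :
    t + ς⁻¹ ∈ firingSet σ f t := by
  have hp : 0 < ς⁻¹ := inv_pos.2 hς
  refine ⟨by linarith, ?_⟩
  have := mul_le_integral_drive hσ hI hς hfσ (by linarith : t ≤ t + ς⁻¹)
  rwa [add_sub_cancel_left, mul_right_comm, mul_inv_cancel₀ hς.ne', one_mul] at this

/-- The accumulated drive is continuous and strictly increasing, so the threshold is first reached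
with equality. -/
theorem firingMap_spec (hσ : 0 ≤ σ) (hI : ∀ a b, IntervalIntegrable f volume a b)
    (hς : 0 < ς) (hfσ : ∀ᵐ t ∂(volume : Measure ℝ), ς < f t - σ) (t : ℝ) :
    t < firingMap σ f t ∧ firingMap σ f t ≤ t + ς⁻¹ ∧
      ∫ u in t..firingMap σ f t, (f u - σ) * Real.exp (σ * u) = Real.exp (σ * t) := by
  have hg := intervalIntegrable_drive hI σ
  obtain ⟨h0, h1⟩ := mem_firingSet_add_inv hσ hI hς hfσ t
  obtain ⟨y, hy, hye⟩ := intermediate_value_Icc h0.le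
    (intervalIntegral.continuous_primitive hg t).continuousOn
    (show Real.exp (σ * t) ∈ Set.Icc _ _ from
      ⟨by simpa using (Real.exp_pos (σ * t)).le, h1⟩)
  have hty : t < y := by
    refine lt_of_le_of_ne hy.1 fun h => ?_
    subst h
    simp only [intervalIntegral.integral_same] at hye
    exact (Real.exp_pos (σ * t)).ne hye
  have hl : IsLeast (firingSet σ f t) y := by
    refine ⟨⟨hty, hye.ge⟩, fun z hz => ?_⟩
    by_contra! hzy
    have a := mul_le_integral_drive hσ hI hς hfσ hzy.le
    have b := intervalIntegral.integral_add_adjacent_intervals (hg t z) (hg z y)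
    have c : 0 < ς * Real.exp (σ * z) * (y - z) := by
      have := sub_pos.2 hzy
      positivity
    have := hz.2
    simp only at hye
    linarith
  have : firingMap σ f t = y := hl.csInf_eq
  rw [this]
  exact ⟨hty, hy.2, hye⟩

theorem integral_drive_add_exp_sub_exp (hI : ∀ a b, IntervalIntegrable f volume a b)
    (σ s t : ℝ) :
    (∫ u in s..t, (f u - σ) * Real.exp (σ * u)) + Real.exp (σ * t) - Real.exp (σ * s)
      = ∫ u in s..t, f u * Real.exp (σ * u) := by
  have hd : ∀ u ∈ Set.uIcc s t,
      HasDerivAt (fun u => Real.exp (σ * u)) (σ * Real.exp (σ * u)) u := by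
    intro u _
    have := ((hasDerivAt_id u).const_mul σ).exp
    simpa [mul_comm] using this
  have hi : IntervalIntegrable (fun u => σ * Real.exp (σ * u)) volume s t :=
    (by fun_prop : Continuous fun u => σ * Real.exp (σ * u)).intervalIntegrable _ _
  have e := intervalIntegral.integral_eq_sub_of_hasDerivAt hd hi
  rw [add_sub_assoc, ← e, ← intervalIntegral.integral_add (intervalIntegrable_drive hI σ s t) hi]
  congr 1
  ext u
  ring

/-- The increments of the firing map: the drive between two firing times equals the input
between the two starting times. -/
theorem integral_drive_firingMap (hσ : 0 ≤ σ) (hI : ∀ a b, IntervalIntegrable f volume a b)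
    (hς : 0 < ς) (hfσ : ∀ᵐ t ∂(volume : Measure ℝ), ς < f t - σ) (s t : ℝ) :
    ∫ u in firingMap σ f s..firingMap σ f t, (f u - σ) * Real.exp (σ * u)
      = ∫ u in s..t, f u * Real.exp (σ * u) := by
  have hg := intervalIntegrable_drive hI σ
  have es := (firingMap_spec hσ hI hς hfσ s).2.2
  have et := (firingMap_spec hσ hI hς hfσ t).2.2
  have a := intervalIntegral.integral_add_adjacent_intervals (hg s (firingMap σ f s))
    (hg (firingMap σ f s) (firingMap σ f t))
  have b := intervalIntegral.integral_add_adjacent_intervals (hg s t) (hg t (firingMap σ f t))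
  rw [← integral_drive_add_exp_sub_exp hI]
  linarith

/-- A reversal of order would make a positive drive equal to minus a nonnegative input. -/
theorem firingMap_monotone (hσ : 0 ≤ σ) (hI : ∀ a b, IntervalIntegrable f volume a b)
    (hς : 0 < ς) (hfσ : ∀ᵐ t ∂(volume : Measure ℝ), ς < f t - σ) :
    Monotone (firingMap σ f) := by
  intro s t hst
  by_contra! h
  have a := mul_le_integral_drive hσ hI hς hfσ h.le
  rw [integral_drive_firingMap hσ hI hς hfσ, intervalIntegral.integral_symm] at a
  have b : 0 ≤ ∫ u in s..t, f u * Real.exp (σ * u) := by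
    refine intervalIntegral.integral_nonneg_of_ae hst ?_
    filter_upwards [hfσ] with u hu
    exact mul_nonneg (by linarith) (Real.exp_pos _).le
  have c : 0 < ς * Real.exp (σ * firingMap σ f t) * (firingMap σ f s - firingMap σ f t) := by
    have := sub_pos.2 h
    positivity
  linarith

theorem integral_mul_exp_le (hσ : 0 ≤ σ) {g : ℝ → ℝ}
    (hI : ∀ a b, IntervalIntegrable g volume a b) {s t : ℝ} (hst : s ≤ t) :
    |∫ u in s..t, g u * Real.exp (σ * u)| ≤ Real.exp (σ * t) * ∫ u in s..t, |g u| := by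
  refine (intervalIntegral.abs_integral_le_integral_abs hst).trans ?_
  rw [← intervalIntegral.integral_const_mul]
  refine intervalIntegral.integral_mono_on hst (intervalIntegrable_mul_exp hI σ s t).abs
    ((hI s t).abs.const_mul _) fun u hu => ?_
  rw [abs_mul, abs_of_pos (Real.exp_pos _), mul_comm]
  exact mul_le_mul_of_nonneg_right (Real.exp_le_exp.2 (mul_le_mul_of_nonneg_left hu.2 hσ))
    (abs_nonneg _)

/-- Between `x` and `Φ x` the integral of `f u * exp (σ * u)` is `exp (σ * Φ x)`, so `|f|` has
integral at least `1` there, which short intervals cannot supply. -/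
theorem exists_add_le_firingMap (hσ : 0 ≤ σ) (hf : StepanovAlmostPeriodic f)
    (hς : 0 < ς) (hfσ : ∀ᵐ t ∂(volume : Measure ℝ), ς < f t - σ) :
    ∃ d > 0, ∀ x, x + d ≤ firingMap σ f x := by
  have hI := hf.intervalIntegrable
  obtain ⟨h, h0, h1, hh⟩ := hf.exists_integral_abs_le (ε := Real.exp (-σ) / 2) (by positivity)
  refine ⟨h, h0, fun x => ?_⟩
  by_contra! hlt
  obtain ⟨s1, -, s3⟩ := firingMap_spec hσ hI hς hfσ x
  have a := hh x _ s1.le hlt.le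
  have b := integral_drive_add_exp_sub_exp hI σ x (firingMap σ f x)
  have c := (le_abs_self _).trans (integral_mul_exp_le hσ hI s1.le)
  have e2 : Real.exp (-σ) ≤ 1 := Real.exp_le_one_iff.2 (by linarith)
  have := Real.exp_pos (σ * firingMap σ f x)
  nlinarith

theorem firingMap_uniformContinuous (hσ : 0 ≤ σ) (hf : StepanovAlmostPeriodic f)
    (hς : 0 < ς) (hfσ : ∀ᵐ t ∂(volume : Measure ℝ), ς < f t - σ) :
    ∀ ε > 0, ∃ η > 0, ∀ x y, |x - y| ≤ η → |firingMap σ f x - firingMap σ f y| ≤ ε := by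
  have hI := hf.intervalIntegrable
  intro ε hε
  obtain ⟨h, h0, h1, hh⟩ := hf.exists_integral_abs_le (ε := ς * ε * Real.exp (-σ))
    (by positivity)
  have key : ∀ s t, s ≤ t → t ≤ s + h → firingMap σ f t - firingMap σ f s ≤ ε := by
    intro s t hst hts
    have a := hh s t hst hts
    have b := mul_le_integral_drive hσ hI hς hfσ (firingMap_monotone hσ hI hς hfσ hst)
    rw [integral_drive_firingMap hσ hI hς hfσ] at b
    have c := (le_abs_self _).trans (integral_mul_exp_le hσ hI hst)
    have s1 := (firingMap_spec hσ hI hς hfσ s).1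
    have e1 : Real.exp (σ * t) * Real.exp (-σ) ≤ Real.exp (σ * firingMap σ f s) := by
      rw [← Real.exp_add]
      exact Real.exp_le_exp.2 (by nlinarith)
    have e2 : Real.exp (σ * t) * ∫ u in s..t, |f u|
        ≤ Real.exp (σ * firingMap σ f s) * (ς * ε) := by
      calc _ ≤ Real.exp (σ * t) * (ς * ε * Real.exp (-σ)) := by gcongr
        _ = Real.exp (σ * t) * Real.exp (-σ) * (ς * ε) := by ring
        _ ≤ _ := by gcongr
    refine le_of_mul_le_mul_left ?_ (mul_pos hς (Real.exp_pos (σ * firingMap σ f s)))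
    linarith
  refine ⟨h, h0, fun x y hxy => ?_⟩
  rw [abs_le] at hxy
  have hm := firingMap_monotone hσ hI hς hfσ
  rw [abs_le]
  rcases le_total x y with hle | hle
  · have := key x y hle (by linarith)
    have := hm hle
    constructor <;> linarith
  · have := key y x hle (by linarith)
    have := hm hle
    constructor <;> linarith

theorem mul_abs_sub_le_abs_integral_drive (hσ : 0 ≤ σ)
    (hI : ∀ a b, IntervalIntegrable f volume a b)
    (hς : 0 < ς) (hfσ : ∀ᵐ t ∂(volume : Measure ℝ), ς < f t - σ) {x y z : ℝ}
    (hy : x ≤ y) (hz : x ≤ z) :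
    ς * Real.exp (σ * x) * |z - y| ≤ |∫ u in y..z, (f u - σ) * Real.exp (σ * u)| := by
  have key : ∀ {a b : ℝ}, x ≤ a → a ≤ b → ς * Real.exp (σ * x) * (b - a)
      ≤ |∫ u in a..b, (f u - σ) * Real.exp (σ * u)| := by
    intro a b ha hab
    refine le_trans ?_ ((mul_le_integral_drive hσ hI hς hfσ hab).trans (le_abs_self _))
    have : 0 ≤ b - a := sub_nonneg.2 hab
    gcongr
  rcases le_total y z with h | h
  · rw [abs_of_nonneg (sub_nonneg.2 h)]
    exact key hy h
  · rw [abs_sub_comm, abs_of_nonneg (sub_nonneg.2 h), intervalIntegral.integral_symm, abs_neg]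
    exact key hz h

theorem exists_firingMap_almost_commute (hσ : 0 ≤ σ) (hf : StepanovAlmostPeriodic f)
    (hς : 0 < ς) (hfσ : ∀ᵐ t ∂(volume : Measure ℝ), ς < f t - σ) {η : ℝ} (hη : 0 < η) :
    ∃ ε > 0, ∀ τ ∈ stepanovAlmostPeriods ε f,
      ∀ x, |firingMap σ f (x + τ) - τ - firingMap σ f x| ≤ η := by
  have hI := hf.intervalIntegrable
  obtain ⟨N, hN⟩ := exists_nat_gt ς⁻¹
  have hN0 : (0 : ℝ) < N := (inv_pos.2 hς).trans hN
  -- At most `N` unit windows separate `x` from the firing time, and the exponential weight varies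
  -- by at most `exp (σ * N)` there.
  refine ⟨ς * η * Real.exp (-(σ * N)) / N, by positivity, fun τ hτ x => ?_⟩
  obtain ⟨s1, -, s3⟩ := firingMap_spec hσ hI hς hfσ x
  obtain ⟨t1, t2, t3⟩ := firingMap_spec hσ hI hς hfσ (x + τ)
  set y := firingMap σ f x
  -- `z` is the firing time from `x` under the shifted input; the change of input over `[x, z]`
  -- controls `|z - y|`.
  obtain ⟨z, hz⟩ : ∃ z, firingMap σ f (x + τ) = z + τ := ⟨_, (sub_add_cancel _ τ).symm⟩
  rw [hz] at t1 t2 t3 ⊢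
  rw [add_sub_cancel_right]
  have hxz : x ≤ z := by linarith
  have hzN : z ≤ x + N := by linarith
  have hIτ := intervalIntegrable_shift hI τ
  have e1 : ∫ u in x..z, (f (u + τ) - σ) * Real.exp (σ * u) = Real.exp (σ * x) := by
    rw [← intervalIntegral.integral_comp_add_right
      (fun u => (f u - σ) * Real.exp (σ * u))] at t3
    simp only [mul_add, Real.exp_add] at t3
    simp only [← mul_assoc] at t3
    rw [intervalIntegral.integral_mul_const] at t3
    exact mul_right_cancel₀ (Real.exp_pos _).ne' t3
  have e2 : ∫ u in x..z, (f (u + τ) - f u) * Real.exp (σ * u)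
      = - ∫ u in y..z, (f u - σ) * Real.exp (σ * u) := by
    have a := intervalIntegral.integral_add_adjacent_intervals
      (intervalIntegrable_drive hI σ x y) (intervalIntegrable_drive hI σ y z)
    have b := intervalIntegral.integral_sub (intervalIntegrable_drive hIτ σ x z)
      (intervalIntegrable_drive hI σ x z)
    have c : (fun u => (f (u + τ) - f u) * Real.exp (σ * u)) =
        fun u => (f (u + τ) - σ) * Real.exp (σ * u) - (f u - σ) * Real.exp (σ * u) := by
      ext u; ring
    rw [c, b]
    linarith
  have h1 := integral_mul_exp_le hσ (g := fun u => f (u + τ) - f u)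
    (fun a b => (hIτ a b).sub (hI a b)) hxz
  rw [e2, abs_neg] at h1
  have h2 := integral_le_mul_of_mem_stepanovAlmostPeriods hI (by positivity) hτ N hxz hzN
  rw [mul_div_cancel₀ _ hN0.ne'] at h2
  have h3 := mul_abs_sub_le_abs_integral_drive hσ hI hς hfσ s1.le hxz
  have h4 : Real.exp (σ * z) * Real.exp (-(σ * N)) ≤ Real.exp (σ * x) := by
    rw [← Real.exp_add]
    exact Real.exp_le_exp.2 (by nlinarith)
  have h5 : Real.exp (σ * z) * ∫ u in x..z, |f (u + τ) - f u| ≤ Real.exp (σ * x) * (ς * η) := by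
    calc _ ≤ Real.exp (σ * z) * (ς * η * Real.exp (-(σ * N))) := by gcongr
      _ = Real.exp (σ * z) * Real.exp (-(σ * N)) * (ς * η) := by ring
      _ ≤ _ := by gcongr
  refine le_of_mul_le_mul_left ?_ (mul_pos hς (Real.exp_pos (σ * x)))
  linarith

end Firing

theorem mainTheorem2 (σ : ℝ) (hσ : 0 ≤ σ) (f : ℝ → ℝ) (hf : StepanovAlmostPeriodic f)
    (ς : ℝ) (hς : 0 < ς) (hfσ : ∀ᵐ t ∂(volume : Measure ℝ), ς < f t - σ) :
    ∃ r : ℝ, 0 < r ∧ ∀ t : ℝ, HasFiringRate σ f t r := by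
  have hI := hf.intervalIntegrable
  obtain ⟨d, hd0, hd⟩ := exists_add_le_firingMap hσ hf hς hfσ
  obtain ⟨ρ, hρ, h⟩ := exists_rotation_number (firingMap_monotone hσ hI hς hfσ) hd0 hd
    (fun x => (firingMap_spec hσ hI hς hfσ x).2.1) (by
      intro k
      obtain ⟨η, hη, hk⟩ := iterate_almost_commute
        (firingMap_uniformContinuous hσ hf hς hfσ) k d hd0
      obtain ⟨ε, hε, hτ⟩ := exists_firingMap_almost_commute hσ hf hς hfσ hη
      obtain ⟨l, -, hl⟩ := hf.relativelyDense ε hε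
      refine ⟨l, fun a => ?_⟩
      obtain ⟨τ, h1, h2, h3⟩ := hl a
      exact ⟨τ, h2, h3, hk τ (hτ τ h1)⟩)
  -- `ρ` is the mean interspike interval.
  refine ⟨ρ⁻¹, inv_pos.2 hρ, fun t =>
    ⟨fun n => ⟨_, mem_firingSet_add_inv hσ hI hς hfσ _⟩, ?_⟩⟩
  simpa only [inv_div] using (h t).inv₀ hρ.ne'
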